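/- Let $N\ge 1$, $S=[0,1]^2$, and let $\delta>2N$, $\delta\delta'=N$, $w=\delta/N$. An $N$-to-1 horseshoe map is a map $f:\mathbb R^2\to\mathbb R^2$ of the following kind. On $S$, $f$ is the composition of: (i) the linear map $(x,y)\mapsto(\delta x,\delta' y)$ of $S$ onto $[0,\delta]\times[0,\delta']$; (ii) cutting or folding $[0,\delta]\times[0,\delta']$ along the lines $u=iw$, $0<i<N$, and laying the $N$ pieces on top of each other on $R=[0,w]\times[0,\delta']$, each by a horizontal translation (reduction modulo $w$) or by a horizontal reflection (folding); (iii) a continuous injective map $R\to\mathbb R^2$ ("bending") which carries two legs $[p_a,p_a+1]\times[0,\delta']$ and $[p_b,p_b+1]\times[0,\delta']$, where $0\le p_a$, $p_a+1<p_b$, $p_b+1\le w$, rigidly (up to reversing the horizontal and/or vertical direction) onto horizontal rectangles $H_a=[0,1]\times[h_a,h_a+\delta']$ and $H_b=[0,1]\times[h_b,h_b+\delta']$ contained in $S$, and carries all other points of $R$ outside $S$. For $1\le i\le N$ let $V_{0^i}$, respectively $V_{1^i}$, be the closed vertical rectangle of the points of $S$ which (i) and (ii) carry, within the $i$-th piece,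 to the leg $a$, respectively $b$. It is required that these $2N$ rectangles be pairwise disjoint, and that $f^{-(k+1)}(S)\cap S\subseteq f^{-k}(S)\cap S$ for all $k\ge1$. On a cut line, $f$ takes the value given by one of the two adjacent pieces, namely by the piece of the rectangle $V_s$ containing that line if there is one. Put $\Lambda_H=\bigcap_{k\ge0}f^k(S)\cap S$, $\Lambda_V=\bigcap_{k\ge0}f^{-k}(S)\cap S$ and $\Lambda=\Lambda_H\cap\Lambda_V$. Let $\mathcal A=\{a,b\}$, $\mathcal A'=\{0^1,\dots,0^N,1^1,\dots,1^N\}$, and $\varphi_1(0^i)=a$, $\varphi_1(1^i)=b$. The full zip shift space $\Sigma_{\mathcal A,\mathcal A'}$ is the set of all sequences $(x_i)_{i\in\mathbb Z}$ for which there is $y\in(\mathcal A')^{\mathbb Z}$ with $x_i=y_i$ for $i\ge0$ and $x_i=\varphi_1(y_i)$ for $i<0$, with the topology generated by the cylinders; the zip shift map is $(\sigma x)_{-1}=\varphi_1(x_0)$, $(\sigma x)_i=x_{i+1}$ for $i\ne-1$. A sequence $(n_i)_{i\in\mathbb Z}$ with $n_i\in\mathcal A'$ for $i\ge0$ and $n_i\in\mathcal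 A$ for $i<0$ is a code of a point $p$ if $p\in\bigcap_{k\ge0}f^{-k}(V_{n_k})\cap\bigcap_{k\ge1}f^{k-1}(H_{n_{-k}})$. Theorem. There are a Cantor set $C_1\subset\mathbb R$ and a set $C_2\subset\mathbb R$ homeomorphic to the middle-third Cantor set such that $\Lambda_V=C_1\times[0,1]$, $\Lambda_H=[0,1]\times C_2$ and $\Lambda=C_1\times C_2$, and $f(\Lambda)=\Lambda$. The set of all codes is exactly $\Sigma_{\mathcal A,\mathcal A'}$; a point has a code if and only if it lies in $\Lambda$, and its code is then unique. The code map $\varsigma:\Lambda\to\Sigma_{\mathcal A,\mathcal A'}$, sending each point to its code, is a homeomorphism, $\sigma$ maps $\Sigma_{\mathcal A,\mathcal A'}$ into itself, and $\varsigma\circ f|_\Lambda=\sigma\circ\varsigma$; that is, $f:\Lambda\to\Lambda$ and $\sigma:\Sigma_{\mathcal A,\mathcal A'}\to\Sigma_{\mathcal A,\mathcal A'}$ are topologically conjugate via $\varsigma$. -/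

import Mathlib

/-! ### Zip shift spaces -/

namespace ZipShift

/-- The zip shift space over the alphabets `A`, `A'` determined by a transition map `φ : A' → A` on
words of length one and a two-sided shift space `Y ⊆ A'^ℤ`: all `x` arising from some `y ∈ Y` as
`x i = y i ∈ A'` for `i ≥ 0` and `x i = φ (y i) ∈ A` for `i < 0`. -/
def zipShiftSpace {A A' : Type} (φ : A' → A) (Y : Set (ℤ → A')) : Set (ℤ → A ⊕ A') :=
  {x | ∃ y ∈ Y, ∀ i : ℤ, x i = if 0 ≤ i then Sum.inr (y i) else Sum.inl (φ (y i))}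

/-- The full zip shift space: `Y` is the full two-sided shift. -/
def fullZipShiftSpace {A A' : Type} (φ : A' → A) : Set (ℤ → A ⊕ A') :=
  zipShiftSpace φ Set.univ

/-- The zip shift map: `(σ x) (-1) = φ (x 0)` and `(σ x) i = x (i + 1)` for `i ≠ -1`.
(On a zip shift space `x 0` is always a letter of `A'`.) -/
def zipShiftMap {A A' : Type} (φ : A' → A) (x : ℤ → A ⊕ A') : ℤ → A ⊕ A' :=
  fun i => if i = -1 then Sum.inl (Sum.elim id φ (x 0)) else x (i + 1)

end ZipShift

/-! ### The `N`-to-1 horseshoe -/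

namespace Horseshoe

/-- The alphabet `𝒜 = {a, b}`. -/
inductive Alph : Type
  | a
  | b

/-- The alphabet `𝒜' = {0^1, …, 0^N} ∪ {1^1, …, 1^N}` of size `2N`
(superscripts are numbered from `0` to `N - 1` here). -/
inductive Alph' (N : ℕ) : Type
  | zero (i : Fin N)
  | one (i : Fin N)

/-- Alphabets are discrete, so that `ℤ → 𝒜 ⊕ 𝒜'` has the product topology, whose basis is formed by
the cylinders. -/
instance : TopologicalSpace Alph := ⊥

instance (N : ℕ) : TopologicalSpace (Alph' N) := ⊥

/-- The transition map `φ₁`: `0^i ↦ a`, `1^i ↦ b`. -/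
def phi {N : ℕ} : Alph' N → Alph
  | .zero _ => .a
  | .one _ => .b

/-- The superscript of a letter of `𝒜'`. -/
def superscript {N : ℕ} : Alph' N → Fin N
  | .zero i => i
  | .one i => i

/-- The unit square `S = [0,1] × [0,1]`. -/
def square : Set (ℝ × ℝ) := Set.Icc 0 1 ×ˢ Set.Icc 0 1

/-- The parameters of an `N`-to-1 horseshoe map. The square is stretched to `[0, δ] × [0, δ']`, that
rectangle is cut or folded along the lines `u = i δ / N` into `N` pieces which are laid on top of each
other on `[0, δ / N] × [0, δ']`, and the result is bent back so that exactly two of its portions of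
length `1` (the legs) cross the square. -/
structure Config (N : ℕ) where
  /-- horizontal expansion factor -/
  δ : ℝ
  /-- vertical contraction factor -/
  δ' : ℝ
  two_mul_lt : 2 * (N : ℝ) < δ
  mul_eq : δ * δ' = N
  /-- Whether the `i`-th piece is laid down by a reflection or by a translation: always by a
  translation when reducing modulo `δ / N`, alternately when folding successively. -/
  reflected : Fin N → Bool
  /-- left ends of the two legs inside `[0, δ / N]` -/
  leg : Alph → ℝ
  leg_a_nonneg : 0 ≤ leg .a
  leg_a_lt_leg_b : leg .a + 1 < leg .b
  leg_b_le : leg .b + 1 ≤ δ / N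
  /-- heights at which the two legs are placed in the square -/
  height : Alph → ℝ
  height_nonneg : ∀ c, 0 ≤ height c
  height_le : ∀ c, height c + δ' ≤ 1
  /-- whether the direction of a leg is reversed, horizontally and vertically, by the bending -/
  turnX : Alph → Bool
  turnY : Alph → Bool

namespace Config

variable {N : ℕ} (d : Config N)

/-- The length `δ / N` of each of the `N` pieces. -/
noncomputable def width : ℝ := d.δ / N

/-- The `i`-th of the `N` pieces of `[0, δ]`. -/
def piece (i : Fin N) : Set ℝ := Set.Icc ((i : ℝ) * d.width) (((i : ℝ) + 1) * d.width)

/-- How the `i`-th piece is laid on `[0, δ / N]`. -/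
noncomputable def overlay (i : Fin N) (u : ℝ) : ℝ :=
  if d.reflected i then ((i : ℝ) + 1) * d.width - u else u - (i : ℝ) * d.width

/-- The stretched and overlaid image of the point `p` of the square, regarded as a point of the
`i`-th piece. -/
noncomputable def stretch (i : Fin N) (p : ℝ × ℝ) : ℝ × ℝ :=
  (d.overlay i (d.δ * p.1), d.δ' * p.2)

/-- The rectangle `[0, δ / N] × [0, δ']` before it is bent. -/
def strip : Set (ℝ × ℝ) := Set.Icc 0 d.width ×ˢ Set.Icc 0 d.δ'

/-- The horizontal extent of a leg. -/
def legInterval (c : Alph) : Set ℝ := Set.Icc (d.leg c) (d.leg c + 1)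

/-- The rigid motion which puts the leg `c` into the square. -/
noncomputable def place (c : Alph) (q : ℝ × ℝ) : ℝ × ℝ :=
  (if d.turnX c then d.leg c + 1 - q.1 else q.1 - d.leg c,
   if d.turnY c then d.height c + d.δ' - q.2 else d.height c + q.2)

/-- The horizontal rectangles `H_a`, `H_b`. -/
def H (c : Alph) : Set (ℝ × ℝ) :=
  Set.Icc 0 1 ×ˢ Set.Icc (d.height c) (d.height c + d.δ')

/-- The vertical rectangles `V_{0^i}`, `V_{1^i}`: the part of the square which is stretched and
overlaid, within the `i`-th piece, onto the leg `a`, respectively `b`. -/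
def V (s : Alph' N) : Set (ℝ × ℝ) :=
  {p ∈ square | d.δ * p.1 ∈ d.piece (superscript s) ∧
    d.overlay (superscript s) (d.δ * p.1) ∈ d.legInterval (phi s)}

/-- `B` bends `[0, δ / N] × [0, δ']` back to the square: it is an embedding which puts the two legs
rigidly across the square and everything else outside of it. -/
structure IsBend (B : ℝ × ℝ → ℝ × ℝ) : Prop where
  continuousOn : ContinuousOn B d.strip
  injOn : Set.InjOn B d.strip
  leg_eq : ∀ c, ∀ q ∈ d.strip, q.1 ∈ d.legInterval c → B q = d.place c q
  notMem : ∀ q ∈ d.strip, (∀ c, q.1 ∉ d.legInterval c) → B q ∉ square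

/-- `f` is an `N`-to-1 horseshoe map with the parameters `d`: on the square it is the composition of
stretching, overlaying and bending; the `2N` vertical rectangles are disjoint; and
`f^{-(k+1)}(S) ∩ S ⊆ f^{-k}(S) ∩ S`, i.e. orbits which start in `S` and leave it do not return.
On a cut line the value is the one given by one of the two adjacent pieces, namely the piece of the
vertical rectangle bounded by that line, if there is such a rectangle. -/
structure IsHorseshoeMap (f : ℝ × ℝ → ℝ × ℝ) : Prop where
  disjoint_V : ∀ s t : Alph' N, s ≠ t → Disjoint (d.V s) (d.V t)
  exists_bend : ∃ B : ℝ × ℝ → ℝ × ℝ, d.IsBend B ∧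
    (∀ p ∈ square, ∃ i : Fin N, d.δ * p.1 ∈ d.piece i ∧ f p = B (d.stretch i p)) ∧
    (∀ s : Alph' N, ∀ p ∈ d.V s, f p = B (d.stretch (superscript s) p))
  nested : ∀ k : ℕ, 1 ≤ k → square ∩ f^[k + 1] ⁻¹' square ⊆ square ∩ f^[k] ⁻¹' square

/-- `V_{n_0, …, n_k}`. -/
def vRect (f : ℝ × ℝ → ℝ × ℝ) (n : ℕ → Alph' N) : ℕ → Set (ℝ × ℝ)
  | 0 => d.V (n 0)
  | k + 1 => vRect f n k ∩ f^[k + 1] ⁻¹' d.V (n (k + 1))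

/-- `H_{n_{-(k+1)}, …, n_{-1}}`, where `m j` stands for `n_{-(j+1)}`. -/
def hRect (f : ℝ × ℝ → ℝ × ℝ) (m : ℕ → Alph) : ℕ → Set (ℝ × ℝ)
  | 0 => d.H (m 0)
  | k + 1 => hRect f m k ∩ f^[k + 1] '' d.H (m (k + 1))

/-- The bi-infinite sequence `x`, with letters in `𝒜'` at the places `i ≥ 0` and letters in `𝒜` at
the places `i < 0`, is a code of the point `p`: `p` lies in
`(lim V_{x_0, …, x_k}) ∩ (lim H_{x_{-k}, …, x_{-1}})`. -/
def IsCode (f : ℝ × ℝ → ℝ × ℝ) (p : ℝ × ℝ) (x : ℤ → Alph ⊕ Alph' N) : Prop :=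
  ∃ (n : ℕ → Alph' N) (m : ℕ → Alph),
    (∀ j : ℕ, x (j : ℤ) = Sum.inr (n j)) ∧ (∀ j : ℕ, x (-((j : ℤ) + 1)) = Sum.inl (m j)) ∧
    p ∈ (⋂ k, d.vRect f n k) ∩ (⋂ k, d.hRect f m k)

/-- The set of all codes of points. -/
def codeSpace (f : ℝ × ℝ → ℝ × ℝ) : Set (ℤ → Alph ⊕ Alph' N) :=
  {x | ∃ p, d.IsCode f p x}

end Config

/-- `Λ_H = lim f^k(S) ∩ S`. -/
def lambdaH (f : ℝ × ℝ → ℝ × ℝ) : Set (ℝ × ℝ) := ⋂ k : ℕ, f^[k] '' square ∩ square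

/-- `Λ_V = lim f^{-k}(S) ∩ S`. -/
def lambdaV (f : ℝ × ℝ → ℝ × ℝ) : Set (ℝ × ℝ) := ⋂ k : ℕ, f^[k] ⁻¹' square ∩ square

/-- The invariant set `Λ = Λ_H ∩ Λ_V`. -/
def lambda (f : ℝ × ℝ → ℝ × ℝ) : Set (ℝ × ℝ) := lambdaH f ∩ lambdaV f

/-- A Cantor set in `ℝ`: nonempty, compact, perfect and totally disconnected. -/
structure IsCantorSet (C : Set ℝ) : Prop where
  nonempty : C.Nonempty
  isCompact : IsCompact C
  perfect : Perfect C
  isTotallyDisconnected : IsTotallyDisconnected C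

end Horseshoe

/-! In suitable coordinates the horseshoe map is a product. `colContr s` maps `[0,1]` affinely onto
the horizontal extent of `V s`, `rowContr c` onto the vertical extent of `H c`, and on `V s` the map
reads `(colContr s x, y) ↦ (x, rowContr (phi s) y)` (`apply_colContr`); points of the square outside
every `V s` leave it at once (`exists_mem_V`). Both families are contractions with disjoint images:
the columns by hypothesis, the rows because the bending is injective. So each sequence of letters
addresses exactly one point of the attractor, and `point` embeds the sequence space into the line.

A forward orbit in the square reads off an address of the abscissa, whence `mem_lambdaV_iff`. For
the past, nestedness keeps an orbit segment with both ends in the square inside it, so its final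
ordinate lies in a cell of the row system; the cells for different lengths have compatible addresses
by disjointness, whence `mem_lambdaH_iff`.

Hence the invariant set is the product of the two attractors, parametrised by pairs (future, past)
through `codedPoint`. On pairs, `f` deletes the first letter `s` of the future and puts `phi s` in
front of the past (`apply_codedPoint`). Writing pairs as bi-infinite sequences by `zipSeq` turns
this into the zip shift. -/

/-! ### Coding of the attractor of an iterated function system on `[0,1]` -/

namespace UnitIFS

open Set Filter Topology

/-- The one-sided shift. -/
def tail {E : Type} (w : ℕ → E) : ℕ → E := fun k => w (k + 1)

/-- The sequence `w` preceded by the letter `e`. -/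
def cons {E : Type} (e : E) (w : ℕ → E) : ℕ → E
  | 0 => e
  | k + 1 => w k

/-- A system of injective contractions of `[0,1]` with a common ratio and disjoint images. -/
structure IsSystem {E : Type} (g : E → ℝ → ℝ) (r : ℝ) : Prop where
  nonneg : 0 ≤ r
  lt_one : r < 1
  dist_eq : ∀ e x y, |g e x - g e y| = r * |x - y|
  injective : ∀ e, Function.Injective (g e)
  mapsTo : ∀ e, MapsTo (g e) (Icc 0 1) (Icc 0 1)
  eq_of_eq : ∀ e e', ∀ x ∈ Icc (0 : ℝ) 1, ∀ y ∈ Icc (0 : ℝ) 1, g e x = g e' y → e = e'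

/-- The composition `g (w 0) ∘ ⋯ ∘ g (w (k - 1))`. -/
def comp {E : Type} (g : E → ℝ → ℝ) : (ℕ → E) → ℕ → ℝ → ℝ
  | _, 0 => id
  | w, k + 1 => g (w 0) ∘ comp g (tail w) k

namespace IsSystem

/-! ### Cells, addresses and points of the attractor. -/

variable {E : Type} {g : E → ℝ → ℝ} {r : ℝ}

theorem continuous (h : IsSystem g r) (e : E) : Continuous (g e) := by
  refine LipschitzWith.continuous (K := ⟨r, h.nonneg⟩) (LipschitzWith.of_dist_le_mul fun x y => ?_)
  rw [Real.dist_eq, Real.dist_eq, h.dist_eq]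
  rfl

theorem continuous_comp (h : IsSystem g r) (w : ℕ → E) (k : ℕ) : Continuous (comp g w k) := by
  induction k generalizing w with
  | zero => exact continuous_id
  | succ k ih => exact (h.continuous _).comp (ih _)

theorem comp_mapsTo (h : IsSystem g r) (w : ℕ → E) (k : ℕ) :
    MapsTo (comp g w k) (Icc 0 1) (Icc 0 1) := by
  induction k generalizing w with
  | zero => exact mapsTo_id _
  | succ k ih => exact (h.mapsTo _).comp (ih _)

theorem abs_comp_sub_comp (h : IsSystem g r) (w : ℕ → E) (k : ℕ) (x y : ℝ) :
    |comp g w k x - comp g w k y| = r ^ k * |x - y| := by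
  induction k generalizing w with
  | zero => simp [comp]
  | succ k ih => simp only [comp, Function.comp, h.dist_eq, ih]; ring

theorem abs_sub_le (h : IsSystem g r) {w : ℕ → E} {k : ℕ} {x y : ℝ}
    (hx : x ∈ comp g w k '' Icc 0 1) (hy : y ∈ comp g w k '' Icc 0 1) : |x - y| ≤ r ^ k := by
  obtain ⟨a, ha, rfl⟩ := hx
  obtain ⟨b, hb, rfl⟩ := hy
  rw [h.abs_comp_sub_comp]
  refine mul_le_of_le_one_right (pow_nonneg h.nonneg k) ?_
  rw [abs_le]
  constructor <;> linarith [ha.1, ha.2, hb.1, hb.2]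

theorem eq_of_forall_mem (h : IsSystem g r) {w : ℕ → E} {x y : ℝ}
    (hx : ∀ k, x ∈ comp g w k '' Icc 0 1) (hy : ∀ k, y ∈ comp g w k '' Icc 0 1) : x = y := by
  have hlim := tendsto_pow_atTop_nhds_zero_of_lt_one h.nonneg h.lt_one
  have := ge_of_tendsto' hlim fun k => h.abs_sub_le (hx k) (hy k)
  exact sub_eq_zero.1 (abs_nonpos_iff.1 this)

theorem image_comp_succ_subset (h : IsSystem g r) (w : ℕ → E) (k : ℕ) :
    comp g w (k + 1) '' Icc 0 1 ⊆ comp g w k '' Icc 0 1 := by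
  induction k generalizing w with
  | zero =>
    simp only [comp, Function.comp_id, id_eq, image_id]
    exact (h.mapsTo _).image_subset
  | succ k ih =>
    rw [comp.eq_2 g w (k + 1), comp.eq_2 g w k, image_comp, image_comp]
    exact image_mono (ih _)

theorem image_comp_antitone (h : IsSystem g r) (w : ℕ → E) :
    Antitone fun k => comp g w k '' Icc (0 : ℝ) 1 :=
  antitone_nat_of_succ_le (h.image_comp_succ_subset w)

theorem comp_congr {w w' : ℕ → E} {k : ℕ} (hw : ∀ j < k, w j = w' j) :
    comp g w k = comp g w' k := by
  induction k generalizing w w' with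
  | zero => rfl
  | succ k ih =>
    rw [comp, comp, hw 0 (Nat.succ_pos k),
      ih (w := tail w) (w' := tail w') fun j hj => hw (j + 1) (Nat.succ_lt_succ hj)]

/-- Peel off the outermost branch: disjointness of the images forces the first letters to agree, and
injectivity then cancels that branch. -/
theorem eq_of_mem_of_mem (h : IsSystem g r) {w w' : ℕ → E} {k : ℕ} {x : ℝ}
    (hx : x ∈ comp g w k '' Icc 0 1) (hx' : x ∈ comp g w' k '' Icc 0 1) :
    ∀ j < k, w j = w' j := by
  induction k generalizing w w' x with
  | zero => exact fun j hj => absurd hj (Nat.not_lt_zero j)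
  | succ k ih =>
    obtain ⟨a, ha, rfl⟩ := hx
    obtain ⟨b, hb, hab⟩ := hx'
    simp only [comp, Function.comp] at hab
    have h0 : w' 0 = w 0 := h.eq_of_eq _ _ _ (h.comp_mapsTo _ _ hb) _ (h.comp_mapsTo _ _ ha) hab
    rw [h0] at hab
    have ht := h.injective _ hab
    intro j hj
    cases j with
    | zero => exact h0.symm
    | succ j =>
      exact ih (w := tail w) (w' := tail w') ⟨a, ha, rfl⟩ ⟨b, hb, ht⟩ j (Nat.lt_of_succ_lt_succ hj)

/-- `comp` unfolds at the outermost branch; here the innermost one, applied first, is split off. -/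
theorem comp_succ_apply (w : ℕ → E) (k : ℕ) (x : ℝ) :
    comp g w (k + 1) x = comp g w k (g (w k) x) := by
  induction k generalizing w with
  | zero => rfl
  | succ k ih => exact congrArg (g (w 0)) (ih (tail w))

theorem exists_forall_mem (h : IsSystem g r) (w : ℕ → E) :
    ∃ x, ∀ k, x ∈ comp g w k '' Icc (0 : ℝ) 1 := by
  obtain ⟨x, hx⟩ := IsCompact.nonempty_iInter_of_sequence_nonempty_isCompact_isClosed
    (fun k => comp g w k '' Icc (0 : ℝ) 1) (h.image_comp_succ_subset w)
    (fun k => (nonempty_Icc.2 zero_le_one).image _)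
    (isCompact_Icc.image (h.continuous_comp w 0))
    (fun k => (isCompact_Icc.image (h.continuous_comp w k)).isClosed)
  exact ⟨x, mem_iInter.1 hx⟩

/-- The point of the attractor with the address `w`. -/
noncomputable def point (h : IsSystem g r) (w : ℕ → E) : ℝ := (h.exists_forall_mem w).choose

theorem point_mem_image (h : IsSystem g r) (w : ℕ → E) (k : ℕ) :
    h.point w ∈ comp g w k '' Icc 0 1 :=
  (h.exists_forall_mem w).choose_spec k

theorem point_mem (h : IsSystem g r) (w : ℕ → E) : h.point w ∈ Icc (0 : ℝ) 1 := by
  simpa [comp] using h.point_mem_image w 0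

theorem eq_point (h : IsSystem g r) {w : ℕ → E} {x : ℝ}
    (hx : ∀ k, x ∈ comp g w k '' Icc 0 1) : x = h.point w :=
  h.eq_of_forall_mem hx (h.point_mem_image w)

theorem map_point_tail (h : IsSystem g r) (w : ℕ → E) :
    g (w 0) (h.point (tail w)) = h.point w := by
  refine h.eq_point fun k => h.image_comp_succ_subset w k ?_
  rw [comp, image_comp]
  exact mem_image_of_mem _ (h.point_mem_image _ k)

theorem point_cons (h : IsSystem g r) (e : E) (w : ℕ → E) :
    h.point (cons e w) = g e (h.point w) :=
  (h.map_point_tail (cons e w)).symm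

theorem mem_image_of_orbit {w : ℕ → E} {x : ℕ → ℝ} (hmem : ∀ k, x k ∈ Icc (0 : ℝ) 1)
    (hx : ∀ k, x k = g (w k) (x (k + 1))) (k : ℕ) : x 0 ∈ comp g w k '' Icc 0 1 := by
  induction k generalizing w x with
  | zero => simpa [comp] using hmem 0
  | succ k ih =>
    rw [comp, image_comp, hx 0]
    exact mem_image_of_mem _
      (ih (w := tail w) (x := fun k => x (k + 1)) (fun k => hmem _) fun k => hx _)

/-- A point with an infinite orbit of inverse branches inside `[0,1]` has the address given by
those branches. -/
theorem eq_point_of_orbit (h : IsSystem g r) {w : ℕ → E} {x : ℕ → ℝ}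
    (hmem : ∀ k, x k ∈ Icc (0 : ℝ) 1) (hx : ∀ k, x k = g (w k) (x (k + 1))) :
    x 0 = h.point w :=
  h.eq_point fun k => mem_image_of_orbit hmem hx k

/-- The addresses of the cells containing a given point fit together. -/
theorem eq_point_diagonal (h : IsSystem g r) {w : ℕ → ℕ → E} {x : ℝ}
    (hx : ∀ k, x ∈ comp g (w k) (k + 1) '' Icc 0 1) : x = h.point fun k => w k k := by
  refine h.eq_point fun k => ?_
  have hk : comp g (w k) k = comp g (fun j => w j j) k := by
    refine comp_congr fun j hj => ?_
    -- The depth `j + 1` cells of `w k` and `w j` both contain `x`, so these addresses agree up to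
    -- and including place `j`.
    exact h.eq_of_mem_of_mem (h.image_comp_antitone (w k) (show j + 1 ≤ k + 1 by omega) (hx k))
      (hx j) j (Nat.lt_succ_self j)
  rw [← hk]
  exact h.image_comp_succ_subset _ _ (hx k)

theorem point_injective (h : IsSystem g r) : Function.Injective h.point := by
  intro w w' hw
  funext k
  exact h.eq_of_mem_of_mem (h.point_mem_image w (k + 1)) (hw ▸ h.point_mem_image w' (k + 1)) k
    (Nat.lt_succ_self k)

theorem abs_point_sub_point_le (h : IsSystem g r) {w w' : ℕ → E} {k : ℕ}
    (hw : ∀ j < k, w j = w' j) : |h.point w - h.point w'| ≤ r ^ k := by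
  refine h.abs_sub_le (h.point_mem_image w k) ?_
  rw [comp_congr hw]
  exact h.point_mem_image w' k

/-! ### The attractor as a Cantor set. -/

section Topology

variable [TopologicalSpace E] [DiscreteTopology E]

/-- Agreement on the first `k` letters is an open condition on sequences and confines the point to a
cell of diameter at most `r ^ k`. -/
theorem continuous_point (h : IsSystem g r) : Continuous h.point := by
  rw [continuous_iff_continuousAt]
  intro w
  rw [ContinuousAt, Metric.tendsto_nhds]
  intro ε hε
  obtain ⟨k, hk⟩ := exists_pow_lt_of_lt_one hε h.lt_one
  have hev : ∀ᶠ w' in 𝓝 w, ∀ j ∈ Finset.range k, w' j = w j := by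
    rw [Filter.eventually_all_finset]
    intro j _
    have hc : ContinuousAt (fun w' : ℕ → E => w' j) w := (continuous_apply j).continuousAt
    exact hc.eventually (show ∀ᶠ e in 𝓝 (w j), e = w j by rw [nhds_discrete]; simp)
  filter_upwards [hev] with w' hw'
  rw [Real.dist_eq]
  exact (h.abs_point_sub_point_le fun j hj => hw' j (Finset.mem_range.2 hj)).trans_lt hk

theorem isClosedEmbedding_point [Finite E] (h : IsSystem g r) : IsClosedEmbedding h.point :=
  h.continuous_point.isClosedEmbedding h.point_injective

theorem perfect_range_point [Finite E] [Nontrivial E] (h : IsSystem g r) :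
    Perfect (range h.point) := by
  refine ⟨h.isClosedEmbedding_point.isClosed_range, ?_⟩
  rintro _ ⟨w, rfl⟩
  rw [accPt_iff_nhds]
  intro U hU
  obtain ⟨ε, hε, hεU⟩ := Metric.mem_nhds_iff.1 hU
  obtain ⟨k, hk⟩ := exists_pow_lt_of_lt_one hε h.lt_one
  -- Changing only the letter at place `k` moves the point by at most `r ^ k`, and does move it,
  -- since addresses are unique.
  obtain ⟨e, he⟩ := exists_ne (w k)
  refine ⟨h.point (Function.update w k e), ⟨hεU ?_, mem_range_self _⟩, fun heq => he ?_⟩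
  · rw [Metric.mem_ball, Real.dist_eq]
    exact (h.abs_point_sub_point_le fun j hj => Function.update_of_ne hj.ne _ _).trans_lt hk
  · simpa using congrFun (h.point_injective heq) k

theorem isCantorSet_range_point [Finite E] [Nontrivial E] (h : IsSystem g r) :
    Horseshoe.IsCantorSet (range h.point) where
  nonempty := range_nonempty _
  isCompact := isCompact_range h.continuous_point
  perfect := h.perfect_range_point
  isTotallyDisconnected :=
    h.isClosedEmbedding_point.isEmbedding.isTotallyDisconnected_range.2 inferInstance

end Topology

end IsSystem

end UnitIFS

/-! ### The horizontal and vertical contractions of a horseshoe -/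

namespace Horseshoe

open Set Filter Topology UnitIFS

instance : DiscreteTopology Alph := ⟨rfl⟩

instance (N : ℕ) : DiscreteTopology (Alph' N) := ⟨rfl⟩

/-- `𝒜` has two letters. -/
def alphEquivBool : Alph ≃ Bool where
  toFun | .a => false | .b => true
  invFun | false => .a | true => .b
  left_inv c := by cases c <;> rfl
  right_inv c := by cases c <;> rfl

/-- `𝒜'` has `2N` letters. -/
def alph'EquivSum (N : ℕ) : Alph' N ≃ Fin N ⊕ Fin N where
  toFun | .zero i => .inl i | .one i => .inr i
  invFun | .inl i => .zero i | .inr i => .one i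
  left_inv c := by cases c <;> rfl
  right_inv c := by cases c <;> rfl

instance : Finite Alph := Finite.of_equiv _ alphEquivBool.symm

instance (N : ℕ) : Finite (Alph' N) := Finite.of_equiv _ (alph'EquivSum N).symm

theorem exists_phi_superscript {N : ℕ} (i : Fin N) (c : Alph) :
    ∃ s : Alph' N, superscript s = i ∧ phi s = c := by
  cases c
  · exact ⟨.zero i, rfl, rfl⟩
  · exact ⟨.one i, rfl, rfl⟩

theorem phi_surjective {N : ℕ} (hN : 1 ≤ N) : Function.Surjective (phi (N := N)) := fun c =>
  (exists_phi_superscript ⟨0, hN⟩ c).imp fun _ h => h.2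

theorem nontrivial_alph' {N : ℕ} (hN : 1 ≤ N) : Nontrivial (Alph' N) :=
  ⟨.zero ⟨0, hN⟩, .one ⟨0, hN⟩, nofun⟩

namespace Config

variable {N : ℕ} (d : Config N)

/-- The vertical contraction of the square onto `H_c`. -/
noncomputable def rowContr (c : Alph) (y : ℝ) : ℝ :=
  if d.turnY c then d.height c + d.δ' - d.δ' * y else d.height c + d.δ' * y

/-- The position in the leg `c` of the point which the bending puts at the abscissa `x`. -/
noncomputable def legCoord (c : Alph) (x : ℝ) : ℝ :=
  if d.turnX c then d.leg c + 1 - x else d.leg c + x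

/-- The inverse of `Config.overlay`. -/
noncomputable def unfold (i : Fin N) (q : ℝ) : ℝ :=
  if d.reflected i then ((i : ℝ) + 1) * d.width - q else q + (i : ℝ) * d.width

/-- The horizontal contraction of the square onto `V_s`. -/
noncomputable def colContr (s : Alph' N) (x : ℝ) : ℝ :=
  d.unfold (superscript s) (d.legCoord (phi s) x) / d.δ

/-! ### Geometry of the legs and rectangles. -/

variable {d}

theorem δ_pos : 0 < d.δ := lt_of_le_of_lt (by positivity) d.two_mul_lt

theorem one_lt_δ (hN : 1 ≤ N) : 1 < d.δ := by
  have : (1 : ℝ) ≤ N := by exact_mod_cast hN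
  linarith [d.two_mul_lt]

theorem δ'_pos (hN : 1 ≤ N) : 0 < d.δ' := by
  have h1 : (0 : ℝ) < N := by exact_mod_cast hN
  have h2 := d.mul_eq
  have h3 := d.δ_pos
  by_contra! h
  nlinarith

theorem δ'_lt_one : d.δ' < 1 := by
  have h1 : (0 : ℝ) ≤ N := Nat.cast_nonneg N
  have h2 := d.mul_eq
  have h3 := d.δ_pos
  have h4 := d.two_mul_lt
  by_contra! h
  nlinarith

theorem mul_width (hN : 1 ≤ N) : (N : ℝ) * d.width = d.δ := by
  have h1 : (0 : ℝ) < N := by exact_mod_cast hN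
  rw [width]
  field_simp

theorem legInterval_subset (c : Alph) : d.legInterval c ⊆ Icc 0 d.width := by
  have h1 := d.leg_a_nonneg
  have h2 := d.leg_a_lt_leg_b
  have h3 : d.leg .b + 1 ≤ d.width := d.leg_b_le
  cases c <;> exact Icc_subset_Icc (by linarith) (by linarith)

theorem eq_of_mem_legInterval {c c' : Alph} {q : ℝ} (h : q ∈ d.legInterval c)
    (h' : q ∈ d.legInterval c') : c = c' := by
  have h2 := d.leg_a_lt_leg_b
  simp only [legInterval, mem_Icc] at h h'
  cases c <;> cases c' <;> first | rfl | (exfalso; linarith)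

theorem legCoord_mem (c : Alph) {x : ℝ} (hx : x ∈ Icc (0 : ℝ) 1) :
    d.legCoord c x ∈ d.legInterval c := by
  simp only [legCoord, legInterval, mem_Icc] at *
  split_ifs <;> constructor <;> linarith

theorem exists_legCoord_eq {c : Alph} {q : ℝ} (hq : q ∈ d.legInterval c) :
    ∃ x ∈ Icc (0 : ℝ) 1, q = d.legCoord c x := by
  simp only [legCoord, legInterval, mem_Icc] at *
  split_ifs
  · exact ⟨d.leg c + 1 - q, ⟨by linarith, by linarith⟩, by ring⟩
  · exact ⟨q - d.leg c, ⟨by linarith, by linarith⟩, by ring⟩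

theorem overlay_unfold (i : Fin N) (q : ℝ) : d.overlay i (d.unfold i q) = q := by
  simp only [overlay, unfold]
  split_ifs <;> ring

theorem unfold_overlay (i : Fin N) (u : ℝ) : d.unfold i (d.overlay i u) = u := by
  simp only [overlay, unfold]
  split_ifs <;> ring

theorem unfold_mem_piece (i : Fin N) {q : ℝ} (hq : q ∈ Icc 0 d.width) :
    d.unfold i q ∈ d.piece i := by
  simp only [unfold, piece, mem_Icc] at *
  split_ifs <;> constructor <;> linarith

theorem overlay_mem (i : Fin N) {u : ℝ} (hu : u ∈ d.piece i) : d.overlay i u ∈ Icc 0 d.width := by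
  simp only [overlay, piece, mem_Icc] at *
  split_ifs <;> constructor <;> linarith

theorem piece_subset (hN : 1 ≤ N) (i : Fin N) : d.piece i ⊆ Icc 0 d.δ := by
  have hw : 0 ≤ d.width := div_nonneg d.δ_pos.le (Nat.cast_nonneg N)
  have hi : (i : ℝ) + 1 ≤ N := by exact_mod_cast i.2
  refine Icc_subset_Icc (by positivity) ?_
  rw [← d.mul_width hN]
  exact mul_le_mul_of_nonneg_right hi hw

theorem δ_mul_colContr (s : Alph' N) (x : ℝ) :
    d.δ * d.colContr s x = d.unfold (superscript s) (d.legCoord (phi s) x) :=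
  mul_div_cancel₀ _ d.δ_pos.ne'

theorem colContr_mapsTo (hN : 1 ≤ N) (s : Alph' N) :
    MapsTo (d.colContr s) (Icc 0 1) (Icc 0 1) := by
  intro x hx
  have h := d.piece_subset hN _ (d.unfold_mem_piece (superscript s)
    (d.legInterval_subset _ (d.legCoord_mem (phi s) hx)))
  exact ⟨div_nonneg h.1 d.δ_pos.le, div_le_one_of_le₀ h.2 d.δ_pos.le⟩

/-- The overlay and the placement of the leg are invertible, so `V s` is parametrised by the
abscissa that its points have after bending. -/
theorem mem_V_iff (hN : 1 ≤ N) {s : Alph' N} {p : ℝ × ℝ} :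
    p ∈ d.V s ↔ (∃ x ∈ Icc (0 : ℝ) 1, p.1 = d.colContr s x) ∧ p.2 ∈ Icc (0 : ℝ) 1 := by
  constructor
  · rintro ⟨hS, -, hleg⟩
    obtain ⟨x, hx, hq⟩ := d.exists_legCoord_eq hleg
    refine ⟨⟨x, hx, ?_⟩, hS.2⟩
    rw [colContr, ← hq, unfold_overlay, mul_div_cancel_left₀ _ d.δ_pos.ne']
  · rintro ⟨⟨x, hx, hpx⟩, hy⟩
    have hl := d.legCoord_mem (phi s) hx
    refine ⟨⟨hpx ▸ d.colContr_mapsTo hN s hx, hy⟩, ?_, ?_⟩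
    · rw [hpx, δ_mul_colContr]
      exact d.unfold_mem_piece _ (d.legInterval_subset _ hl)
    · rw [hpx, δ_mul_colContr, overlay_unfold]
      exact hl

theorem rowContr_mem (hN : 1 ≤ N) (c : Alph) {y : ℝ} (hy : y ∈ Icc (0 : ℝ) 1) :
    d.rowContr c y ∈ Icc (d.height c) (d.height c + d.δ') := by
  have h := d.δ'_pos hN
  have h1 : 0 ≤ d.δ' * y := mul_nonneg h.le hy.1
  have h2 : d.δ' * y ≤ d.δ' := mul_le_of_le_one_right h.le hy.2
  simp only [rowContr, mem_Icc]
  split_ifs <;> constructor <;> linarith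

theorem mem_H_iff (hN : 1 ≤ N) {c : Alph} {p : ℝ × ℝ} :
    p ∈ d.H c ↔ p.1 ∈ Icc (0 : ℝ) 1 ∧ ∃ y ∈ Icc (0 : ℝ) 1, p.2 = d.rowContr c y := by
  refine and_congr_right fun _ => ⟨fun h => ?_, ?_⟩
  · have hδ := d.δ'_pos hN
    simp only [mem_Icc] at h
    have h1 : 0 ≤ (p.2 - d.height c) / d.δ' := div_nonneg (by linarith) hδ.le
    have h2 : (p.2 - d.height c) / d.δ' ≤ 1 := div_le_one_of_le₀ (by linarith) hδ.le
    simp only [rowContr]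
    split_ifs
    · exact ⟨1 - (p.2 - d.height c) / d.δ', ⟨by linarith, by linarith⟩, by field_simp; ring⟩
    · exact ⟨(p.2 - d.height c) / d.δ', ⟨h1, h2⟩, by field_simp; ring⟩
  · rintro ⟨y, hy, h⟩
    exact h ▸ d.rowContr_mem hN c hy

theorem rowContr_mapsTo (hN : 1 ≤ N) (c : Alph) : MapsTo (d.rowContr c) (Icc 0 1) (Icc 0 1) :=
  fun _ hy => Icc_subset_Icc (d.height_nonneg c) (d.height_le c) (d.rowContr_mem hN c hy)

theorem place_legCoord (c : Alph) (x y : ℝ) :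
    d.place c (d.legCoord c x, d.δ' * y) = (x, d.rowContr c y) := by
  simp only [place, legCoord, rowContr, Prod.mk.injEq]
  constructor
  · split_ifs <;> ring
  · trivial

theorem mul_mem_of_mem (hN : 1 ≤ N) {y : ℝ} (hy : y ∈ Icc (0 : ℝ) 1) :
    d.δ' * y ∈ Icc 0 d.δ' :=
  ⟨mul_nonneg (d.δ'_pos hN).le hy.1, mul_le_of_le_one_right (d.δ'_pos hN).le hy.2⟩

theorem IsBend.map_legCoord {B : ℝ × ℝ → ℝ × ℝ} (hB : d.IsBend B) (hN : 1 ≤ N) (c : Alph) {x y : ℝ}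
    (hx : x ∈ Icc (0 : ℝ) 1) (hy : y ∈ Icc (0 : ℝ) 1) :
    B (d.legCoord c x, d.δ' * y) = (x, d.rowContr c y) := by
  have hl := d.legCoord_mem c hx
  rw [hB.leg_eq c _ ⟨d.legInterval_subset c hl, d.mul_mem_of_mem hN hy⟩ hl, place_legCoord]

theorem abs_rowContr_sub (hN : 1 ≤ N) (c : Alph) (x y : ℝ) :
    |d.rowContr c x - d.rowContr c y| = d.δ' * |x - y| := by
  simp only [rowContr]
  split_ifs
  · rw [show d.height c + d.δ' - d.δ' * x - (d.height c + d.δ' - d.δ' * y) = -(d.δ' * (x - y)) by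
      ring, abs_neg, abs_mul, abs_of_pos (d.δ'_pos hN)]
  · rw [show d.height c + d.δ' * x - (d.height c + d.δ' * y) = d.δ' * (x - y) by
      ring, abs_mul, abs_of_pos (d.δ'_pos hN)]

theorem abs_unfold_sub (i : Fin N) (x y : ℝ) :
    |d.unfold i x - d.unfold i y| = |x - y| := by
  simp only [unfold]
  split_ifs
  · rw [sub_sub_sub_cancel_left, abs_sub_comm]
  · rw [add_sub_add_right_eq_sub]

theorem abs_legCoord_sub (c : Alph) (x y : ℝ) :
    |d.legCoord c x - d.legCoord c y| = |x - y| := by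
  simp only [legCoord]
  split_ifs
  · rw [sub_sub_sub_cancel_left, abs_sub_comm]
  · rw [add_sub_add_left_eq_sub]

theorem abs_colContr_sub (s : Alph' N) (x y : ℝ) :
    |d.colContr s x - d.colContr s y| = d.δ⁻¹ * |x - y| := by
  rw [colContr, colContr, ← sub_div, abs_div, abs_unfold_sub, abs_legCoord_sub,
    abs_of_pos d.δ_pos, div_eq_inv_mul]

theorem injective_of_abs_sub {g : ℝ → ℝ} {r : ℝ} (hr : 0 < r)
    (h : ∀ x y, |g x - g y| = r * |x - y|) : Function.Injective g := by
  intro x y hxy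
  have := h x y
  rw [hxy, sub_self, abs_zero, zero_eq_mul] at this
  exact sub_eq_zero.1 (abs_eq_zero.1 (this.resolve_left hr.ne'))

theorem IsBend.isSystem_rowContr {B : ℝ × ℝ → ℝ × ℝ} (hB : d.IsBend B) (hN : 1 ≤ N) :
    IsSystem d.rowContr d.δ' where
  nonneg := (d.δ'_pos hN).le
  lt_one := d.δ'_lt_one
  dist_eq := d.abs_rowContr_sub hN
  injective c := injective_of_abs_sub (d.δ'_pos hN) (d.abs_rowContr_sub hN c)
  mapsTo := d.rowContr_mapsTo hN
  eq_of_eq c c' x hx y hy hxy := by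
    -- The heights alone do not separate the two rows. If they met, two points of different legs
    -- would be bent to the same point over abscissa `0`, against injectivity of the bending.
    have h0 : (0 : ℝ) ∈ Icc (0 : ℝ) 1 := ⟨le_rfl, zero_le_one⟩
    have hl := d.legCoord_mem c h0
    have hl' := d.legCoord_mem c' h0
    have heq := hB.injOn
      (show (d.legCoord c 0, d.δ' * x) ∈ d.strip from
        ⟨d.legInterval_subset c hl, d.mul_mem_of_mem hN hx⟩)
      (show (d.legCoord c' 0, d.δ' * y) ∈ d.strip from
        ⟨d.legInterval_subset c' hl', d.mul_mem_of_mem hN hy⟩)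
      (by rw [hB.map_legCoord hN c h0 hx, hB.map_legCoord hN c' h0 hy, hxy])
    rw [← (Prod.mk.inj heq).1] at hl'
    exact d.eq_of_mem_legInterval hl hl'

theorem V_subset (s : Alph' N) : d.V s ⊆ square := fun _ h => h.1

theorem H_subset (c : Alph) : d.H c ⊆ square := fun _ h =>
  ⟨h.1, Icc_subset_Icc (d.height_nonneg c) (d.height_le c) h.2⟩

/-! ### The horseshoe map in product coordinates. -/

namespace IsHorseshoeMap

variable {f : ℝ × ℝ → ℝ × ℝ}

theorem isSystem_rowContr (hf : d.IsHorseshoeMap f) (hN : 1 ≤ N) : IsSystem d.rowContr d.δ' := by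
  obtain ⟨B, hB, -⟩ := hf.exists_bend
  exact hB.isSystem_rowContr hN

theorem isSystem_colContr (hf : d.IsHorseshoeMap f) (hN : 1 ≤ N) :
    IsSystem d.colContr d.δ⁻¹ where
  nonneg := (inv_pos.2 d.δ_pos).le
  lt_one := inv_lt_one_of_one_lt₀ (d.one_lt_δ hN)
  dist_eq := d.abs_colContr_sub
  injective s := injective_of_abs_sub (inv_pos.2 d.δ_pos) (d.abs_colContr_sub s)
  mapsTo := d.colContr_mapsTo hN
  eq_of_eq s t x hx y hy hxy := by
    by_contra hst
    have h0 : (0 : ℝ) ∈ Icc (0 : ℝ) 1 := ⟨le_rfl, zero_le_one⟩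
    exact Set.disjoint_left.1 (hf.disjoint_V s t hst)
      ((d.mem_V_iff hN (p := (d.colContr s x, 0))).2 ⟨⟨x, hx, rfl⟩, h0⟩)
      ((d.mem_V_iff hN).2 ⟨⟨y, hy, hxy⟩, h0⟩)

theorem apply_colContr (hf : d.IsHorseshoeMap f) (hN : 1 ≤ N) (s : Alph' N) {x y : ℝ}
    (hx : x ∈ Icc (0 : ℝ) 1) (hy : y ∈ Icc (0 : ℝ) 1) :
    f (d.colContr s x, y) = (x, d.rowContr (phi s) y) := by
  obtain ⟨B, hB, -, hV⟩ := hf.exists_bend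
  rw [hV s _ ((d.mem_V_iff hN).2 ⟨⟨x, hx, rfl⟩, hy⟩), stretch, δ_mul_colContr, overlay_unfold,
    hB.map_legCoord hN _ hx hy]

/-- On a cut line either adjacent piece may give the value; whichever does, a position outside both
legs is bent out of the square. -/
theorem exists_mem_V (hf : d.IsHorseshoeMap f) (hN : 1 ≤ N) {p : ℝ × ℝ} (hp : p ∈ square)
    (hfp : f p ∈ square) : ∃ s, p ∈ d.V s := by
  obtain ⟨B, hB, hS, -⟩ := hf.exists_bend
  obtain ⟨i, hi, hfi⟩ := hS p hp
  by_contra! hV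
  refine hB.notMem (d.stretch i p) ⟨d.overlay_mem i hi, d.mul_mem_of_mem hN hp.2⟩ ?_ (hfi ▸ hfp)
  intro c hc
  obtain ⟨s, rfl, rfl⟩ := exists_phi_superscript i c
  exact hV s ⟨hp, hi, hc⟩

/-- On each `V_s` the map is the product of an expansion and a contraction. -/
theorem apply_of_mem_V (hf : d.IsHorseshoeMap f) (hN : 1 ≤ N) {s : Alph' N} {p : ℝ × ℝ}
    (hs : p ∈ d.V s) :
    p.1 = d.colContr s (f p).1 ∧ (f p).2 = d.rowContr (phi s) p.2 := by
  obtain ⟨⟨x, hx, hpx⟩, hy⟩ := (d.mem_V_iff hN).1 hs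
  have hfp : f p = (x, d.rowContr (phi s) p.2) := by
    rw [← hf.apply_colContr hN s hx hy, ← hpx]
  exact ⟨by rw [hfp, hpx], by rw [hfp]⟩

/-- Orbits which start in the square and return to it stay there in between. -/
theorem iterate_mem_of_le (hf : d.IsHorseshoeMap f) {p : ℝ × ℝ} (hp : p ∈ square) {j k : ℕ}
    (hjk : j ≤ k) (hk : f^[k] p ∈ square) : f^[j] p ∈ square := by
  induction k, hjk using Nat.le_induction with
  | base => exact hk
  | succ k hjk ih =>
    -- The nestedness hypothesis starts at `k = 1`; for `k = 0` the claim is that the starting point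
    -- lies in the square.
    rcases Nat.eq_zero_or_pos k with rfl | hpos
    · obtain rfl : j = 0 := by omega
      exact hp
    · exact ih (hf.nested k hpos ⟨hp, hk⟩).2

end IsHorseshoeMap

end Config

end Horseshoe

/-! ### The invariant set and its coding -/

namespace Horseshoe

open Set Filter Topology UnitIFS

/-- The homeomorphism of a coded attractor over two letters with the middle-third Cantor set. -/
theorem nonempty_homeomorph_cantorSet {g : Alph → ℝ → ℝ} {r : ℝ} (h : IsSystem g r) :
    Nonempty (range h.point ≃ₜ cantorSet) :=
  ⟨h.isClosedEmbedding_point.isEmbedding.toHomeomorph.symm.trans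
    ((Homeomorph.piCongrRight fun _ => alphEquivBool.toHomeomorphOfDiscrete).trans
      cantorSetHomeomorphNatToBool.symm)⟩

/-! ### Bi-infinite sequences as pairs of one-sided ones. -/

/-- The bi-infinite sequence with the future `z.1` and the past `z.2`. -/
def zipSeq {A A' : Type} (z : (ℕ → A') × (ℕ → A)) : ℤ → A ⊕ A'
  | Int.ofNat j => Sum.inr (z.1 j)
  | Int.negSucc j => Sum.inl (z.2 j)

theorem zipSeq_injective {A A' : Type} :
    Function.Injective (zipSeq : (ℕ → A') × (ℕ → A) → ℤ → A ⊕ A') := by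
  rintro ⟨n, m⟩ ⟨n', m'⟩ h
  refine Prod.ext (funext fun j => ?_) (funext fun j => ?_)
  · exact Sum.inr_injective (congrFun h (Int.ofNat j))
  · exact Sum.inl_injective (congrFun h (Int.negSucc j))

theorem continuous_zipSeq {A A' : Type} [TopologicalSpace A] [TopologicalSpace A'] :
    Continuous (zipSeq : (ℕ → A') × (ℕ → A) → ℤ → A ⊕ A') := by
  refine continuous_pi fun i => ?_
  cases i with
  | ofNat j => exact continuous_inr.comp ((continuous_apply j).comp continuous_fst)
  | negSucc j => exact continuous_inl.comp ((continuous_apply j).comp continuous_snd)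

theorem eq_zipSeq_iff {A A' : Type} {x : ℤ → A ⊕ A'} {n : ℕ → A'} {m : ℕ → A} :
    x = zipSeq (n, m) ↔
      (∀ j : ℕ, x (j : ℤ) = Sum.inr (n j)) ∧ ∀ j : ℕ, x (-((j : ℤ) + 1)) = Sum.inl (m j) := by
  constructor
  · rintro rfl
    refine ⟨fun j => rfl, fun j => ?_⟩
    rw [← Int.negSucc_eq]
    rfl
  · rintro ⟨hn, hm⟩
    funext i
    cases i with
    | ofNat j => exact hn j
    | negSucc j => rw [Int.negSucc_eq]; exact hm j

theorem range_zipSeq {A A' : Type} {φ : A' → A} (hφ : Function.Surjective φ) :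
    range zipSeq = ZipShift.fullZipShiftSpace φ := by
  ext x
  constructor
  · rintro ⟨⟨n, m⟩, rfl⟩
    -- A zip sequence must come from a two-sided sequence over `A'`, so the letters of the past are
    -- lifted along `φ`.
    choose ψ hψ using hφ
    refine ⟨fun | Int.ofNat j => n j | Int.negSucc j => ψ (m j), mem_univ _, fun i => ?_⟩
    cases i with
    | ofNat j => exact (if_pos (Int.natCast_nonneg j)).symm
    | negSucc j =>
      rw [if_neg (not_le.2 (Int.negSucc_lt_zero j)), hψ]
      rfl
  · rintro ⟨y, -, hy⟩
    refine ⟨(fun j => y j, fun j => φ (y (Int.negSucc j))), funext fun i => ?_⟩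
    rw [hy i]
    cases i with
    | ofNat j => exact (if_pos (Int.natCast_nonneg j)).symm
    | negSucc j => exact (if_neg (not_le.2 (Int.negSucc_lt_zero j))).symm

theorem zipShiftMap_zipSeq {A A' : Type} (φ : A' → A) (n : ℕ → A') (m : ℕ → A) :
    ZipShift.zipShiftMap φ (zipSeq (n, m)) = zipSeq (tail n, cons (φ (n 0)) m) := by
  funext i
  match i with
  | Int.ofNat j => exact if_neg (by simp)
  | Int.negSucc 0 => rfl
  | Int.negSucc (j + 1) => exact if_neg (by omega)

/-! ### Itineraries and the sets `lambdaV`, `lambdaH`. -/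

namespace Config

variable {N : ℕ} {d : Config N} {f : ℝ × ℝ → ℝ × ℝ}

theorem mem_iInter_vRect {n : ℕ → Alph' N} {p : ℝ × ℝ} :
    p ∈ ⋂ k, d.vRect f n k ↔ ∀ k, f^[k] p ∈ d.V (n k) := by
  rw [mem_iInter]
  constructor
  · intro h k
    cases k with
    | zero => exact h 0
    | succ k => exact (h (k + 1)).2
  · intro h k
    induction k with
    | zero => exact h 0
    | succ k ih => exact ⟨ih, h (k + 1)⟩

theorem mem_iInter_hRect {m : ℕ → Alph} {p : ℝ × ℝ} :
    p ∈ ⋂ k, d.hRect f m k ↔ ∀ k, p ∈ f^[k] '' d.H (m k) := by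
  have h0 : p ∈ f^[0] '' d.H (m 0) ↔ p ∈ d.hRect f m 0 := by simp [hRect]
  rw [mem_iInter]
  constructor
  · intro h k
    cases k with
    | zero => exact h0.2 (h 0)
    | succ k => exact (h (k + 1)).2
  · intro h k
    induction k with
    | zero => exact h0.1 (h 0)
    | succ k ih => exact ⟨ih, h (k + 1)⟩

namespace IsHorseshoeMap

theorem apply_point (hf : d.IsHorseshoeMap f) (hN : 1 ≤ N) (n : ℕ → Alph' N) {y : ℝ}
    (hy : y ∈ Icc (0 : ℝ) 1) :
    f ((hf.isSystem_colContr hN).point n, y) =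
      ((hf.isSystem_colContr hN).point (tail n), d.rowContr (phi (n 0)) y) := by
  rw [← (hf.isSystem_colContr hN).map_point_tail n,
    hf.apply_colContr hN _ ((hf.isSystem_colContr hN).point_mem _) hy]

theorem iterate_point_mem_V (hf : d.IsHorseshoeMap f) (hN : 1 ≤ N) (n : ℕ → Alph' N) {y : ℝ}
    (hy : y ∈ Icc (0 : ℝ) 1) (k : ℕ) :
    f^[k] ((hf.isSystem_colContr hN).point n, y) ∈ d.V (n k) := by
  induction k generalizing n y with
  | zero =>
    exact (d.mem_V_iff hN).2 ⟨⟨_, (hf.isSystem_colContr hN).point_mem (tail n),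
      ((hf.isSystem_colContr hN).map_point_tail n).symm⟩, hy⟩
  | succ k ih =>
    rw [Function.iterate_succ_apply, hf.apply_point hN n hy]
    exact ih (tail n) (d.rowContr_mapsTo hN _ hy)

/-- The points with a given forward itinerary form a vertical segment. -/
theorem forall_iterate_mem_V_iff (hf : d.IsHorseshoeMap f) (hN : 1 ≤ N) {n : ℕ → Alph' N}
    {p : ℝ × ℝ} : (∀ k, f^[k] p ∈ d.V (n k)) ↔
      p.1 = (hf.isSystem_colContr hN).point n ∧ p.2 ∈ Icc (0 : ℝ) 1 := by
  constructor
  · intro h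
    refine ⟨?_, (h 0).1.2⟩
    refine (hf.isSystem_colContr hN).eq_point_of_orbit (x := fun k => (f^[k] p).1)
      (fun k => (h k).1.1) fun k => ?_
    rw [Function.iterate_succ_apply']
    exact (hf.apply_of_mem_V hN (h k)).1
  · rintro ⟨hx, hy⟩ k
    obtain ⟨x, y⟩ := p
    obtain rfl : x = _ := hx
    exact hf.iterate_point_mem_V hN n hy k

theorem mem_lambdaV_iff (hf : d.IsHorseshoeMap f) (hN : 1 ≤ N) {p : ℝ × ℝ} :
    p ∈ lambdaV f ↔
      p.1 ∈ range (hf.isSystem_colContr hN).point ∧ p.2 ∈ Icc (0 : ℝ) 1 := by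
  constructor
  · intro h
    have hS : ∀ k, f^[k] p ∈ square := fun k => (mem_iInter.1 h k).1
    -- Two consecutive iterates in the square put the earlier one in some `V s`.
    have hV : ∀ k, ∃ s, f^[k] p ∈ d.V s := fun k =>
      hf.exists_mem_V hN (hS k) (Function.iterate_succ_apply' f k p ▸ hS (k + 1))
    choose n hn using hV
    obtain ⟨hx, hy⟩ := (hf.forall_iterate_mem_V_iff hN).1 hn
    exact ⟨⟨n, hx.symm⟩, hy⟩
  · rintro ⟨⟨n, hn⟩, hy⟩
    have h := (hf.forall_iterate_mem_V_iff hN).2 ⟨hn.symm, hy⟩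
    exact mem_iInter.2 fun k => ⟨d.V_subset _ (h k), d.V_subset _ (h 0)⟩

/-- Along an orbit segment in the square the ordinate changes by a composition of the vertical
contractions; the letters beyond the length of the segment are arbitrary. -/
theorem exists_iterate_snd_eq (hf : d.IsHorseshoeMap f) (hN : 1 ≤ N) (c : Alph) {q : ℝ × ℝ}
    (hq : q ∈ square) {k : ℕ} (hk : f^[k] q ∈ square) :
    ∃ w : ℕ → Alph, w k = c ∧ (f^[k] q).2 = comp d.rowContr w k q.2 := by
  induction k with
  | zero => exact ⟨fun _ => c, rfl, rfl⟩
  | succ k ih =>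
    have hk' := hf.iterate_mem_of_le hq (Nat.le_succ k) hk
    obtain ⟨w, hwc, hw⟩ := ih hk'
    rw [Function.iterate_succ_apply'] at hk ⊢
    obtain ⟨s, hs⟩ := hf.exists_mem_V hN hk' hk
    -- The newest contraction is the outermost, so its letter goes in front; this moves the
    -- prescribed letter `c` from place `k` to place `k + 1`.
    refine ⟨cons (phi s) w, hwc, ?_⟩
    rw [(hf.apply_of_mem_V hN hs).2, hw]
    rfl

/-- Preimages are chosen one step at a time: the ordinate loses the first letter of its address, and
the abscissa enters any column lying over that letter. -/
theorem exists_iterate_eq_point (hf : d.IsHorseshoeMap f) (hN : 1 ≤ N) (m : ℕ → Alph) {x : ℝ}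
    (hx : x ∈ Icc (0 : ℝ) 1) (k : ℕ) :
    ∃ q ∈ d.H (m k), f^[k] q = (x, (hf.isSystem_rowContr hN).point m) := by
  have hY := hf.isSystem_rowContr hN
  -- Tracking the exact ordinate makes the induction work: its address is `m` shifted by `k`, which
  -- begins with `m k` and so places the point in `H (m k)`.
  suffices h : ∃ x' ∈ Icc (0 : ℝ) 1,
      f^[k] (x', hY.point fun j => m (j + k)) = (x, hY.point m) by
    obtain ⟨x', hx', h⟩ := h
    refine ⟨_, (d.mem_H_iff hN).2 ⟨hx', hY.point (tail fun j => m (j + k)), hY.point_mem _, ?_⟩, h⟩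
    simpa using (hY.map_point_tail fun j => m (j + k)).symm
  induction k with
  | zero => exact ⟨x, hx, rfl⟩
  | succ k ih =>
    obtain ⟨x', hx', h⟩ := ih
    obtain ⟨s, hs⟩ := phi_surjective hN (m k)
    refine ⟨d.colContr s x', d.colContr_mapsTo hN s hx', ?_⟩
    rw [Function.iterate_succ_apply, hf.apply_colContr hN s hx' (hY.point_mem _), hs, ← h,
      ← hY.map_point_tail fun j => m (j + k)]
    have ht : tail (fun j => m (j + k)) = fun j => m (j + (k + 1)) :=
      funext fun j => congrArg m (by omega)
    rw [ht, zero_add]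

/-- The points with a given backward itinerary form a horizontal segment. -/
theorem forall_mem_image_H_iff (hf : d.IsHorseshoeMap f) (hN : 1 ≤ N) {m : ℕ → Alph}
    {p : ℝ × ℝ} : (∀ k, p ∈ f^[k] '' d.H (m k)) ↔
      p.1 ∈ Icc (0 : ℝ) 1 ∧ p.2 = (hf.isSystem_rowContr hN).point m := by
  constructor
  · intro h
    have hp : p ∈ square := by
      obtain ⟨q, hq, rfl⟩ := h 0
      exact d.H_subset _ hq
    -- The preimage `q` depends on `k`, hence so does the address `w`. Membership of `q` in `H (m
    -- k)` supplies one more contraction, so the depth is `k + 1` and the diagonal of these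
    -- addresses is `m`.
    have hw : ∀ k, ∃ w : ℕ → Alph, w k = m k ∧ p.2 ∈ comp d.rowContr w (k + 1) '' Icc 0 1 := by
      intro k
      obtain ⟨q, hq, rfl⟩ := h k
      obtain ⟨w, hwc, hw⟩ := hf.exists_iterate_snd_eq hN (m k) (d.H_subset _ hq) hp
      obtain ⟨-, y, hy, hqy⟩ := (d.mem_H_iff hN).1 hq
      refine ⟨w, hwc, y, hy, ?_⟩
      rw [IsSystem.comp_succ_apply, hwc, hw, hqy]
    choose w hwm hw using hw
    refine ⟨hp.1, ?_⟩
    rw [(hf.isSystem_rowContr hN).eq_point_diagonal hw, funext hwm]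
  · rintro ⟨hx, hy⟩ k
    obtain ⟨x, y⟩ := p
    obtain rfl : y = _ := hy
    exact hf.exists_iterate_eq_point hN m hx k

theorem mem_lambdaH_iff (hf : d.IsHorseshoeMap f) (hN : 1 ≤ N) {p : ℝ × ℝ} :
    p ∈ lambdaH f ↔
      p.1 ∈ Icc (0 : ℝ) 1 ∧ p.2 ∈ range (hf.isSystem_rowContr hN).point := by
  constructor
  · intro h
    have hp : p ∈ square := (mem_iInter.1 h 0).2
    have hw : ∀ k, ∃ w : ℕ → Alph, p.2 ∈ comp d.rowContr w (k + 1) '' Icc 0 1 := by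
      intro k
      -- Here `q` is only known to lie in the square, so `k + 1` steps are needed for depth `k + 1`;
      -- the letter `.a` passed below is irrelevant.
      obtain ⟨q, hq, hqp⟩ := (mem_iInter.1 h (k + 1)).1
      obtain ⟨w, -, hw⟩ := hf.exists_iterate_snd_eq hN .a hq (hqp ▸ hp)
      exact ⟨w, q.2, hq.2, by rw [← hw, hqp]⟩
    choose w hw using hw
    exact ⟨hp.1, _, ((hf.isSystem_rowContr hN).eq_point_diagonal hw).symm⟩
  · rintro ⟨hx, m, hm⟩
    have h := (hf.forall_mem_image_H_iff hN).2 ⟨hx, hm.symm⟩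
    exact mem_iInter.2 fun k => ⟨image_mono (d.H_subset _) (h k),
      hx, hm ▸ (hf.isSystem_rowContr hN).point_mem m⟩

/-! ### The coding of the invariant set. -/

/-- The point of the invariant set with the forward itinerary `z.1` and the backward itinerary
`z.2`. -/
noncomputable def codedPoint (hf : d.IsHorseshoeMap f) (hN : 1 ≤ N)
    (z : (ℕ → Alph' N) × (ℕ → Alph)) : ℝ × ℝ :=
  Prod.map (hf.isSystem_colContr hN).point (hf.isSystem_rowContr hN).point z

theorem isClosedEmbedding_codedPoint (hf : d.IsHorseshoeMap f) (hN : 1 ≤ N) :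
    IsClosedEmbedding (hf.codedPoint hN) :=
  ((hf.isSystem_colContr hN).continuous_point.prodMap
    (hf.isSystem_rowContr hN).continuous_point).isClosedEmbedding
    ((hf.isSystem_colContr hN).point_injective.prodMap (hf.isSystem_rowContr hN).point_injective)

theorem lambda_eq_prod (hf : d.IsHorseshoeMap f) (hN : 1 ≤ N) :
    lambda f = range (hf.isSystem_colContr hN).point ×ˢ range (hf.isSystem_rowContr hN).point := by
  ext p
  rw [lambda, mem_inter_iff, hf.mem_lambdaH_iff hN, hf.mem_lambdaV_iff hN, mem_prod]
  constructor
  · rintro ⟨⟨-, h2⟩, h1, -⟩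
    exact ⟨h1, h2⟩
  · rintro ⟨⟨n, hn⟩, m, hm⟩
    exact ⟨⟨hn ▸ (hf.isSystem_colContr hN).point_mem n, m, hm⟩, ⟨n, hn⟩,
      hm ▸ (hf.isSystem_rowContr hN).point_mem m⟩

theorem range_codedPoint (hf : d.IsHorseshoeMap f) (hN : 1 ≤ N) :
    range (hf.codedPoint hN) = lambda f := by
  rw [hf.lambda_eq_prod hN]
  exact range_prodMap

theorem apply_codedPoint (hf : d.IsHorseshoeMap f) (hN : 1 ≤ N) (n : ℕ → Alph' N)
    (m : ℕ → Alph) :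
    f (hf.codedPoint hN (n, m)) = hf.codedPoint hN (tail n, cons (phi (n 0)) m) := by
  simp only [codedPoint, Prod.map_apply, IsSystem.point_cons]
  exact hf.apply_point hN n ((hf.isSystem_rowContr hN).point_mem m)

/-- The future determines a vertical segment and the past a horizontal one; they cross in exactly
one point. -/
theorem isCode_iff (hf : d.IsHorseshoeMap f) (hN : 1 ≤ N) {p : ℝ × ℝ}
    {x : ℤ → Alph ⊕ Alph' N} :
    d.IsCode f p x ↔ ∃ z, p = hf.codedPoint hN z ∧ x = zipSeq z := by
  have key : ∀ n m, p ∈ (⋂ k, d.vRect f n k) ∩ (⋂ k, d.hRect f m k) ↔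
      p = hf.codedPoint hN (n, m) := by
    intro n m
    rw [mem_inter_iff, mem_iInter_vRect, mem_iInter_hRect, hf.forall_iterate_mem_V_iff hN,
      hf.forall_mem_image_H_iff hN, Prod.ext_iff]
    constructor
    · rintro ⟨⟨h1, -⟩, -, h2⟩
      exact ⟨h1, h2⟩
    · rintro ⟨h1, h2⟩
      exact ⟨⟨h1, h2 ▸ (hf.isSystem_rowContr hN).point_mem m⟩,
        h1 ▸ (hf.isSystem_colContr hN).point_mem n, h2⟩
  constructor
  · rintro ⟨n, m, hn, hm, hp⟩
    exact ⟨(n, m), (key n m).1 hp, eq_zipSeq_iff.2 ⟨hn, hm⟩⟩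
  · rintro ⟨⟨n, m⟩, hp, hx⟩
    obtain ⟨hn, hm⟩ := eq_zipSeq_iff.1 hx
    exact ⟨n, m, hn, hm, (key n m).2 hp⟩

theorem mapsTo_lambda (hf : d.IsHorseshoeMap f) (hN : 1 ≤ N) :
    MapsTo f (lambda f) (lambda f) := by
  rw [← hf.range_codedPoint hN]
  rintro _ ⟨⟨n, m⟩, rfl⟩
  exact ⟨_, (hf.apply_codedPoint hN n m).symm⟩

theorem image_lambda (hf : d.IsHorseshoeMap f) (hN : 1 ≤ N) : f '' lambda f = lambda f := by
  refine (hf.mapsTo_lambda hN).image_subset.antisymm ?_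
  rw [← hf.range_codedPoint hN]
  rintro _ ⟨⟨n, m⟩, rfl⟩
  -- A preimage arises by moving the first letter of the past to the future, lifted to any letter
  -- over it.
  obtain ⟨s, hs⟩ := phi_surjective hN (m 0)
  refine ⟨_, mem_range_self (cons s n, tail m), ?_⟩
  rw [hf.apply_codedPoint]
  congr 2
  funext k
  cases k with
  | zero => exact hs
  | succ k => rfl

theorem codeSpace_eq (hf : d.IsHorseshoeMap f) (hN : 1 ≤ N) :
    d.codeSpace f = ZipShift.fullZipShiftSpace (phi (N := N)) := by
  rw [← range_zipSeq (phi_surjective hN)]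
  ext x
  constructor
  · rintro ⟨p, hp⟩
    obtain ⟨z, -, rfl⟩ := (hf.isCode_iff hN).1 hp
    exact mem_range_self z
  · rintro ⟨z, rfl⟩
    exact ⟨_, (hf.isCode_iff hN).2 ⟨z, rfl, rfl⟩⟩

/-- The code map. -/
noncomputable def code (hf : d.IsHorseshoeMap f) (hN : 1 ≤ N) :
    lambda f ≃ₜ ZipShift.fullZipShiftSpace (phi (N := N)) :=
  ((Homeomorph.setCongr (hf.range_codedPoint hN).symm).trans
    (hf.isClosedEmbedding_codedPoint hN).isEmbedding.toHomeomorph.symm).trans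
    ((continuous_zipSeq.isClosedEmbedding zipSeq_injective).isEmbedding.toHomeomorph.trans
      (Homeomorph.setCongr (range_zipSeq (phi_surjective hN))))

theorem code_codedPoint (hf : d.IsHorseshoeMap f) (hN : 1 ≤ N)
    (z : (ℕ → Alph' N) × (ℕ → Alph)) (hz : hf.codedPoint hN z ∈ lambda f) :
    (hf.code hN ⟨hf.codedPoint hN z, hz⟩ : ℤ → Alph ⊕ Alph' N) = zipSeq z := by
  have h : (hf.isClosedEmbedding_codedPoint hN).isEmbedding.toHomeomorph.symm
      ⟨hf.codedPoint hN z, mem_range_self z⟩ = z :=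
    (hf.isClosedEmbedding_codedPoint hN).isEmbedding.toHomeomorph.symm_apply_apply z
  exact congrArg zipSeq h

theorem isCode_iff_code_eq (hf : d.IsHorseshoeMap f) (hN : 1 ≤ N) (p : ℝ × ℝ)
    (x : ℤ → Alph ⊕ Alph' N) :
    d.IsCode f p x ↔ ∃ hp : p ∈ lambda f, (hf.code hN ⟨p, hp⟩ : ℤ → _) = x := by
  rw [hf.isCode_iff hN]
  constructor
  · rintro ⟨z, rfl, rfl⟩
    exact ⟨hf.range_codedPoint hN ▸ mem_range_self z, hf.code_codedPoint hN z _⟩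
  · rintro ⟨hp, rfl⟩
    obtain ⟨z, rfl⟩ := (hf.range_codedPoint hN).symm ▸ hp
    exact ⟨z, rfl, hf.code_codedPoint hN z _⟩

theorem mapsTo_zipShiftMap (hN : 1 ≤ N) :
    MapsTo (ZipShift.zipShiftMap (phi (N := N)))
      (ZipShift.fullZipShiftSpace phi) (ZipShift.fullZipShiftSpace phi) := by
  rw [← range_zipSeq (phi_surjective hN)]
  rintro _ ⟨⟨n, m⟩, rfl⟩
  exact ⟨_, (zipShiftMap_zipSeq phi n m).symm⟩

/-- Every point of `lambda f` is a `codedPoint`, and in terms of pairs both maps are `(n, m) ↦ (tail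
n, cons (phi (n 0)) m)`. -/
theorem code_semiconj (hf : d.IsHorseshoeMap f) (hN : 1 ≤ N) :
    Function.Semiconj (hf.code hN) ((hf.mapsTo_lambda hN).restrict f _ _)
      ((mapsTo_zipShiftMap hN).restrict (ZipShift.zipShiftMap _) _ _) := by
  rintro ⟨p, hp⟩
  obtain ⟨⟨n, m⟩, rfl⟩ := (hf.range_codedPoint hN).symm ▸ hp
  refine Subtype.ext ?_
  have hfz := hf.mapsTo_lambda hN hp
  change (hf.code hN ⟨f (hf.codedPoint hN (n, m)), hfz⟩ : ℤ → _) =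
    ZipShift.zipShiftMap phi (hf.code hN ⟨hf.codedPoint hN (n, m), hp⟩ : ℤ → Alph ⊕ Alph' N)
  rw [hf.code_codedPoint, zipShiftMap_zipSeq]
  simp only [hf.apply_codedPoint hN n m]
  exact hf.code_codedPoint hN _ _

end IsHorseshoeMap

end Config

end Horseshoe


theorem theorem4p2 (N : ℕ) (hN : 1 ≤ N) (d : Horseshoe.Config N) (f : ℝ × ℝ → ℝ × ℝ)
    (hf : d.IsHorseshoeMap f) :
    (∃ C₁ C₂ : Set ℝ, Horseshoe.IsCantorSet C₁ ∧ Nonempty (C₂ ≃ₜ cantorSet) ∧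
      Horseshoe.lambdaV f = C₁ ×ˢ Set.Icc 0 1 ∧ Horseshoe.lambdaH f = Set.Icc 0 1 ×ˢ C₂ ∧
      Horseshoe.lambda f = C₁ ×ˢ C₂) ∧
    f '' Horseshoe.lambda f = Horseshoe.lambda f ∧
    d.codeSpace f = ZipShift.fullZipShiftSpace (Horseshoe.phi (N := N)) ∧
    ∃ (hΛ : Set.MapsTo f (Horseshoe.lambda f) (Horseshoe.lambda f))
      (hσ : Set.MapsTo (ZipShift.zipShiftMap (Horseshoe.phi (N := N)))
        (ZipShift.fullZipShiftSpace Horseshoe.phi) (ZipShift.fullZipShiftSpace Horseshoe.phi))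
      (ς : Horseshoe.lambda f ≃ₜ ZipShift.fullZipShiftSpace (Horseshoe.phi (N := N))),
      (∀ (p : ℝ × ℝ) (x : ℤ → Horseshoe.Alph ⊕ Horseshoe.Alph' N),
        d.IsCode f p x ↔ ∃ hp : p ∈ Horseshoe.lambda f, (ς ⟨p, hp⟩ : ℤ → _) = x) ∧
      Function.Semiconj ς (hΛ.restrict f _ _) (hσ.restrict (ZipShift.zipShiftMap _) _ _) := by
  have := Horseshoe.nontrivial_alph' hN
  refine ⟨⟨_, _, (hf.isSystem_colContr hN).isCantorSet_range_point,
    Horseshoe.nonempty_homeomorph_cantorSet (hf.isSystem_rowContr hN),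
    Set.ext fun _ => hf.mem_lambdaV_iff hN, Set.ext fun _ => hf.mem_lambdaH_iff hN,
    hf.lambda_eq_prod hN⟩, hf.image_lambda hN, hf.codeSpace_eq hN, hf.mapsTo_lambda hN,
    Horseshoe.Config.IsHorseshoeMap.mapsTo_zipShiftMap hN, hf.code hN,
    hf.isCode_iff_code_eq hN, hf.code_semiconj hN⟩
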